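/- Let $m \ge 2$, let $D \subset \mathbb{R}^m$ be a bounded domain (a bounded, nonempty, connected open set), and let $u : D \to \mathbb{R}$ be continuous. Let $\lambda > 0$, and suppose that for every $x \in D$ there is $r(x) > 0$ with $\overline{B_{r(x)}(x)} \subset D$ such that $$\left(\frac{2\pi r}{\lambda}\right)^{m/2} J_{m/2}(\lambda r)\, u(x) = \int_{|y|<r} u(x+y)\, dy \qquad \text{for all } r \in (0, r(x)),$$ where $J_\nu$ denotes the Bessel function of the first kind of order $\nu$ and $B_r(x)$ is the open ball of radius $r$ centred at $x$. Then $u$ is metaharmonic in $D$, with the same $\lambda$; that is, $u \in C^2(D)$ and $\nabla^2 u + \lambda^2 u = 0$ in $D$. -/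

import Mathlib

open scoped Laplacian

noncomputable section

/-- The Bessel function of the first kind of real order `ν`, at a real argument `z > 0`:
`J_ν(z) = ∑ₖ (-1)ᵏ / (k! Γ(ν + k + 1)) (z / 2)^(2k + ν)`. (The terms with `ν + k + 1` a pole of the
gamma function vanish, in accordance with the convention `1 / Γ = 0` there.) -/
def besselJ (ν z : ℝ) : ℝ :=
  ∑' k : ℕ, (-1 : ℝ) ^ k / ((k.factorial : ℝ) * Real.Gamma (ν + (k : ℝ) + 1)) *
    (z / 2) ^ (2 * (k : ℝ) + ν)

/-- `u` is metaharmonic in the open set `D`, with parameter `lam`: it is of class `C²` in `D`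
and solves the Helmholtz equation `Δ u + lam² u = 0` there. -/
def IsMetaharmonicOn {m : ℕ} (lam : ℝ) (u : EuclideanSpace ℝ (Fin m) → ℝ)
    (D : Set (EuclideanSpace ℝ (Fin m))) : Prop :=
  ContDiffOn ℝ 2 u D ∧ ∀ x ∈ D, (Δ u) x + lam ^ 2 * u x = 0

/-- The ball of radius `r` centred at `x` is admissible for `D`: its closure lies in `D`. -/
def IsAdmissibleBall {m : ℕ} (D : Set (EuclideanSpace ℝ (Fin m)))
    (x : EuclideanSpace ℝ (Fin m)) (r : ℝ) : Prop :=
  closure (Metric.ball x r) ⊆ D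

end

open MeasureTheory Filter Topology Metric Asymptotics

noncomputable section

/-! The difficulty is regularity: `u` is only continuous, so the Helmholtz equation is first read
through the Blaschke–Privalov Laplacian, the limit of normalized ball averages of `u (x + y) - u x`.
Expanding the Bessel function, the zeroth term of the series is the volume of the ball and cancels
against the centre value, while the first term gives generalized Laplacian `-lam ^ 2 * u x`
(`hasBallLaplacian_of_mean_value`).

Smoothness then follows from a maximum principle. The function `u(x) exp(lam t)` on a space with one
more dimension is formally harmonic. On a ball, compare it with harmonic polynomials that
approximate it uniformly on the sphere (`exists_harmonic_polynomial_near`). At an interior maximum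
the generalized Laplacian in `x` and the classical second derivative in `t` obey the usual sign
rules, so the approximation persists inside (`helmholtzLift_sub_harmonic_le`). A uniform limit of
harmonic polynomials reproduces itself under a smooth radial kernel, hence is smooth
(`contDiffAt_of_uniform_limit_harmonic`), and the slice `t = 0` returns `u`. For `C²` functions the
generalized and classical Laplacians agree, which gives the equation. -/

/-! ### Second-order Taylor expansion. -/

/-- Second order Taylor expansion with Peano remainder. -/
theorem ContDiffAt.isLittleO_taylor_two {E : Type*} [NormedAddCommGroup E] [NormedSpace ℝ E]
    {f : E → ℝ} {x : E} (hf : ContDiffAt ℝ 2 f x) :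
    (fun y => f (x + y) - f x - fderiv ℝ f x y - (1 / 2) * fderiv ℝ (fderiv ℝ f) x y y)
      =o[𝓝 0] fun y => ‖y‖ ^ 2 := by
  have hsymm : ∀ v w, fderiv ℝ (fderiv ℝ f) x v w = fderiv ℝ (fderiv ℝ f) x w v :=
    fun v w => (hf.isSymmSndFDerivAt (by simp)) v w
  have h1 : ContDiffAt ℝ 1 (fderiv ℝ f) x := hf.fderiv_right (by norm_num)
  have h2 : HasFDerivAt (fderiv ℝ f) (fderiv ℝ (fderiv ℝ f) x) x :=
    (h1.differentiableAt (by norm_num)).hasFDerivAt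
  have h3 := (hasFDerivAt_iff_isLittleO_nhds_zero.1 h2)
  have h4 : ∀ᶠ y in 𝓝 (0 : E), DifferentiableAt ℝ f (x + y) := by
    have : Tendsto (fun y => x + y) (𝓝 (0 : E)) (𝓝 x) := by
      have h : Continuous fun y : E => x + y := by fun_prop
      simpa using h.tendsto 0
    refine this.eventually ?_
    filter_upwards [hf.eventually (by simp)] with z hz
    exact hz.differentiableAt (by norm_num)
  rw [isLittleO_iff]
  intro c hc
  have h5 := (isLittleO_iff.1 h3 hc).and h4
  obtain ⟨δ, hδ, hball⟩ := Metric.eventually_nhds_iff_ball.1 h5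
  filter_upwards [ball_mem_nhds (0 : E) hδ] with y hy
  -- By symmetry of the second derivative, the remainder has as its derivative the first-order error
  -- of `fderiv ℝ f`, at most `c * ‖y‖` on this ball. The mean value inequality supplies the second
  -- factor `‖y‖`.
  have key : ∀ z ∈ closedBall (0 : E) ‖y‖, HasFDerivWithinAt
      (fun y => f (x + y) - f x - fderiv ℝ f x y - (1 / 2) * fderiv ℝ (fderiv ℝ f) x y y)
      (fderiv ℝ f (x + z) - fderiv ℝ f x - fderiv ℝ (fderiv ℝ f) x z)
      (closedBall (0 : E) ‖y‖) z := by
    intro z hz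
    have hz' : z ∈ ball (0 : E) δ := by
      rw [mem_ball_zero_iff] at hy ⊢
      exact (mem_closedBall_zero_iff.1 hz).trans_lt hy
    have hd := (hball z hz').2
    have e1 : HasFDerivAt (fun y => f (x + y)) (fderiv ℝ f (x + z)) z :=
      (hasFDerivAt_comp_add_left x).2 hd.hasFDerivAt
    have e2 : HasFDerivAt (fun y => fderiv ℝ (fderiv ℝ f) x y y)
        (fderiv ℝ (fderiv ℝ f) x z + (fderiv ℝ (fderiv ℝ f) x).flip z) z := by
      have := ((fderiv ℝ (fderiv ℝ f) x).hasFDerivAt (x := z)).clm_apply (hasFDerivAt_id z)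
      refine this.congr_fderiv ?_
      ext v; simp
    have e3 := ((e1.sub_const (f x)).sub ((fderiv ℝ f x).hasFDerivAt (x := z))).sub
      (e2.const_mul (1 / 2 : ℝ))
    refine (e3.congr_fderiv ?_).hasFDerivWithinAt
    ext v
    simp [hsymm v z]
    ring
  have bound : ∀ z ∈ closedBall (0 : E) ‖y‖,
      ‖fderiv ℝ f (x + z) - fderiv ℝ f x - fderiv ℝ (fderiv ℝ f) x z‖ ≤ c * ‖y‖ := by
    intro z hz
    have hz2 := mem_closedBall_zero_iff.1 hz
    have hz' : z ∈ ball (0 : E) δ := by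
      rw [mem_ball_zero_iff] at hy ⊢
      exact hz2.trans_lt hy
    exact (hball z hz').1.trans (by gcongr)
  have := (convex_closedBall (0 : E) ‖y‖).norm_image_sub_le_of_norm_hasFDerivWithin_le key bound
    (x := 0) (y := y) (by simp) (by simp)
  simp only [add_zero, sub_self, map_zero, mul_zero, sub_zero]
    at this
  calc _ ≤ _ := this
    _ = _ := by rw [norm_pow, norm_norm]; ring

/-! ### Ball integrals and the generalized Laplacian. -/

section Ball

variable {ι : Type*} [Fintype ι]

theorem integral_ball_comp_isometry (T : EuclideanSpace ℝ ι ≃ₗᵢ[ℝ] EuclideanSpace ℝ ι)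
    (f : EuclideanSpace ℝ ι → ℝ) (r : ℝ) :
    ∫ y in ball 0 r, f (T y) = ∫ y in ball 0 r, f y := by
  have h := T.measurePreserving.setIntegral_preimage_emb
    T.toHomeomorph.measurableEmbedding f (ball 0 r)
  have h2 : T ⁻¹' ball 0 r = ball 0 r := by
    ext y; simp
  rwa [h2] at h

/-- Reflecting the `i`-th coordinate preserves the ball and changes the sign of the integrand. -/
theorem integral_ball_coord_mul_coord [DecidableEq ι] {i j : ι} (hij : i ≠ j) (r : ℝ) :
    ∫ y : EuclideanSpace ℝ ι in ball 0 r, y i * y j = 0 := by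
  have h := integral_ball_comp_isometry (ι := ι) (LinearIsometryEquiv.piLpCongrRight 2
    (fun k => if k = i then LinearIsometryEquiv.neg ℝ else LinearIsometryEquiv.refl ℝ ℝ))
    (fun y => y i * y j) r
  have h2 : ∀ y : EuclideanSpace ℝ ι, (LinearIsometryEquiv.piLpCongrRight 2
    (fun k => if k = i then LinearIsometryEquiv.neg ℝ else LinearIsometryEquiv.refl ℝ ℝ)) y i *
    (LinearIsometryEquiv.piLpCongrRight 2
    (fun k => if k = i then LinearIsometryEquiv.neg ℝ else LinearIsometryEquiv.refl ℝ ℝ)) y j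
     = - (y i * y j) := by
    intro y
    simp [hij.symm]
  simp only [h2, integral_neg] at h
  linarith

theorem integral_ball_coord_sq [DecidableEq ι] (i j : ι) (r : ℝ) :
    ∫ y : EuclideanSpace ℝ ι in ball 0 r, y i * y i =
      ∫ y : EuclideanSpace ℝ ι in ball 0 r, y j * y j := by
  have h := integral_ball_comp_isometry (ι := ι)
    (LinearIsometryEquiv.piLpCongrLeft 2 ℝ ℝ (Equiv.swap i j)) (fun y => y j * y j) r
  rw [← h]
  simp

theorem integral_ball_odd (f : EuclideanSpace ℝ ι → ℝ) (hf : ∀ y, f (-y) = - f y) (r : ℝ) :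
    ∫ y in ball 0 r, f y = 0 := by
  have h := integral_ball_comp_isometry (ι := ι) (LinearIsometryEquiv.neg ℝ) f r
  simp only [LinearIsometryEquiv.coe_neg, hf, integral_neg] at h
  linarith

theorem Continuous.integrableOn_ball_zero {f : EuclideanSpace ℝ ι → ℝ} (hf : Continuous f)
    (x : EuclideanSpace ℝ ι) (r : ℝ) : IntegrableOn f (ball x r) :=
  (hf.continuousOn.integrableOn_compact (isCompact_closedBall x r)).mono_set ball_subset_closedBall

/-- Symmetry of the ball kills the off-diagonal terms and makes the diagonal moments equal, each a
share `1 / n` of the integral of `‖y‖ ^ 2`; only the trace of `B` survives. -/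
theorem integral_ball_bilin [Nonempty ι]
    (B : EuclideanSpace ℝ ι →L[ℝ] EuclideanSpace ℝ ι →L[ℝ] ℝ) (r : ℝ) :
    ∫ y in ball 0 r, B y y =
      (∑ i, B (EuclideanSpace.basisFun ι ℝ i) (EuclideanSpace.basisFun ι ℝ i)) /
        Fintype.card ι * ∫ y : EuclideanSpace ℝ ι in ball 0 r, ‖y‖ ^ 2 := by
  classical
  set e := EuclideanSpace.basisFun ι ℝ with he
  have hB : ∀ y, B y y = ∑ i, ∑ j, (y i * y j) * B (e i) (e j) := by
    intro y
    have hy : y = ∑ i, y i • e i := by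
      have := (e.sum_repr y).symm
      simpa [he] using this
    conv_lhs => rw [hy]
    simp only [map_sum, map_smul, sum_apply, smul_apply,
      smul_eq_mul, Finset.mul_sum]
    rw [Finset.sum_comm]
    refine Finset.sum_congr rfl fun i _ => Finset.sum_congr rfl fun j _ => by ring
  have hint : ∀ i j : ι, IntegrableOn (fun y : EuclideanSpace ℝ ι => y i * y j) (ball 0 r) :=
    fun i j => Continuous.integrableOn_ball_zero (by fun_prop) 0 r
  have hsq : ∀ i : ι, ∫ y : EuclideanSpace ℝ ι in ball 0 r, y i * y i =
      (∫ y : EuclideanSpace ℝ ι in ball 0 r, ‖y‖ ^ 2) / Fintype.card ι := by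
    intro i
    have : ∀ y : EuclideanSpace ℝ ι, ‖y‖ ^ 2 = ∑ j, y j * y j := by
      intro y
      rw [EuclideanSpace.real_norm_sq_eq]
      simp [sq]
    simp only [this]
    rw [integral_finsetSum _ fun j _ => hint j j]
    rw [Finset.sum_congr rfl fun j _ => integral_ball_coord_sq j i r]
    have : (Fintype.card ι : ℝ) ≠ 0 := by exact_mod_cast Fintype.card_ne_zero
    simp [this]
  rw [show (fun y => B y y) = _ from funext hB]
  rw [integral_finsetSum _ fun i _ => integrable_finsetSum _ fun j _ => (hint i j).mul_const _]
  rw [Finset.sum_congr rfl fun i _ => integral_finsetSum _ fun j _ => (hint i j).mul_const _]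
  simp only [integral_mul_const]
  rw [Finset.sum_div, Finset.sum_mul]
  refine Finset.sum_congr rfl fun i _ => ?_
  rw [Finset.sum_eq_single i]
  · rw [hsq]; ring
  · intro j _ hj
    rw [integral_ball_coord_mul_coord hj.symm, zero_mul]
  · simp

theorem integral_ball_norm_sq_pos [Nonempty ι] {r : ℝ} (hr : 0 < r) :
    0 < ∫ y : EuclideanSpace ℝ ι in ball 0 r, ‖y‖ ^ 2 := by
  rw [setIntegral_pos_iff_support_of_nonneg_ae]
  · have : Function.support (fun y : EuclideanSpace ℝ ι => ‖y‖ ^ 2) = {0}ᶜ := by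
      ext y; simp
    rw [this, Set.inter_comm, ← Set.sdiff_eq, measure_sdiff_null (by simp)]
    exact measure_ball_pos _ _ hr
  · exact Eventually.of_forall fun y => by positivity
  · exact Continuous.integrableOn_ball_zero (by fun_prop) 0 r

/-- `L` is the generalized (Blaschke–Privalov) Laplacian of `f` at `x`: the limit of the normalized
differences between the averages of `f` over small balls and its value at the centre. -/
def HasBallLaplacian (f : EuclideanSpace ℝ ι → ℝ) (x : EuclideanSpace ℝ ι) (L : ℝ) : Prop :=
  Tendsto (fun r : ℝ => (∫ y in ball 0 r, (f (x + y) - f x)) /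
    ∫ y : EuclideanSpace ℝ ι in ball 0 r, ‖y‖ ^ 2) (𝓝[>] 0) (𝓝 (L / (2 * Fintype.card ι)))

namespace HasBallLaplacian

variable {f g : EuclideanSpace ℝ ι → ℝ} {x : EuclideanSpace ℝ ι} {L M : ℝ}

theorem eq [Nonempty ι] (hf : HasBallLaplacian f x L) (hg : HasBallLaplacian f x M) : L = M := by
  have h := tendsto_nhds_unique hf hg
  have : (Fintype.card ι : ℝ) ≠ 0 := by exact_mod_cast Fintype.card_ne_zero
  field_simp at h
  exact h

theorem const_mul (hf : HasBallLaplacian f x L) (c : ℝ) :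
    HasBallLaplacian (fun z => c * f z) x (c * L) := by
  have h := Tendsto.const_mul c hf
  unfold HasBallLaplacian
  convert h using 2
  · simp only [← mul_sub, integral_const_mul, mul_div_assoc]
  · ring

theorem eventually_integrableOn {s : Set (EuclideanSpace ℝ ι)} (hf : ContinuousOn f s)
    (hs : s ∈ 𝓝 x) :
    ∀ᶠ r : ℝ in 𝓝[>] 0, IntegrableOn (fun y => f (x + y) - f x) (ball 0 r) := by
  obtain ⟨δ, hδ, hsub⟩ := Metric.nhds_basis_closedBall.mem_iff.1 hs
  filter_upwards [Ioo_mem_nhdsGT hδ] with r hr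
  have hc : ContinuousOn (fun y => f (x + y) - f x) (closedBall 0 δ) := by
    refine ContinuousOn.sub (hf.comp (by fun_prop) ?_) continuousOn_const
    intro y hy
    apply hsub
    simpa using hy
  exact (hc.integrableOn_compact (isCompact_closedBall _ _)).mono_set
    ((ball_subset_ball hr.2.le).trans ball_subset_closedBall)

theorem add {s : Set (EuclideanSpace ℝ ι)} (hs : s ∈ 𝓝 x) (hfs : ContinuousOn f s)
    (hgs : ContinuousOn g s) (hf : HasBallLaplacian f x L) (hg : HasBallLaplacian g x M) :
    HasBallLaplacian (fun z => f z + g z) x (L + M) := by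
  have h := Tendsto.add hf hg
  unfold HasBallLaplacian
  rw [add_div]
  refine h.congr' ?_
  filter_upwards [eventually_integrableOn hfs hs, eventually_integrableOn hgs hs] with r h1 h2
  rw [← add_div, ← integral_add h1 h2]
  congr 2
  ext y
  ring

/-- The integrand is nonpositive on small balls, so this half of the second derivative test needs no
differentiability of `f`. -/
theorem nonpos_of_isLocalMax [Nonempty ι] (hf : HasBallLaplacian f x L) (hx : IsLocalMax f x) :
    L ≤ 0 := by
  have hn : (0 : ℝ) < Fintype.card ι := by exact_mod_cast Fintype.card_pos
  suffices h : L / (2 * Fintype.card ι) ≤ 0 by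
    by_contra! hL
    have : 0 < L / (2 * Fintype.card ι) := by positivity
    linarith
  refine le_of_tendsto hf ?_
  obtain ⟨δ, hδ, hsub⟩ := Metric.eventually_nhds_iff_ball.1 hx
  filter_upwards [Ioo_mem_nhdsGT hδ] with r hr
  refine div_nonpos_of_nonpos_of_nonneg ?_ (integral_ball_norm_sq_pos hr.1).le
  refine setIntegral_nonpos measurableSet_ball fun y hy => ?_
  have := hsub (x + y) (by
    rw [mem_ball_zero_iff] at hy
    simpa using hy.trans hr.2)
  linarith

/-- In the Taylor expansion the linear term is odd and integrates to zero, and the quadratic term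
contributes half the trace over `n`. This is the origin of the normalization `2 * Fintype.card ι`.
-/
theorem of_contDiffAt [Nonempty ι] (hf : ContDiffAt ℝ 2 f x) : HasBallLaplacian f x
    (∑ i, fderiv ℝ (fderiv ℝ f) x (EuclideanSpace.basisFun ι ℝ i)
      (EuclideanSpace.basisFun ι ℝ i)) := by
  have hn : (0 : ℝ) < Fintype.card ι := by exact_mod_cast Fintype.card_pos
  set S := (∑ i, fderiv ℝ (fderiv ℝ f) x (EuclideanSpace.basisFun ι ℝ i)
      (EuclideanSpace.basisFun ι ℝ i)) with hS
  obtain ⟨s, hs, hcs⟩ : ∃ s ∈ 𝓝 x, ContinuousOn f s := by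
    obtain ⟨s, hs, h⟩ := hf.contDiffOn (m := 2) le_rfl (by simp)
    exact ⟨s, by simpa using hs, ContDiffOn.continuousOn h⟩
  rw [HasBallLaplacian, Metric.tendsto_nhds]
  intro ε hε
  have ho := isLittleO_iff.1 hf.isLittleO_taylor_two (half_pos hε)
  obtain ⟨δ, hδ, hball⟩ := Metric.eventually_nhds_iff_ball.1 ho
  filter_upwards [Ioo_mem_nhdsGT hδ, eventually_integrableOn hcs hs] with r hr hint
  set I := ∫ y : EuclideanSpace ℝ ι in ball 0 r, ‖y‖ ^ 2 with hI
  have hIpos : 0 < I := integral_ball_norm_sq_pos hr.1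
  have hi1 : IntegrableOn (fun y => fderiv ℝ f x y) (ball 0 r) :=
    Continuous.integrableOn_ball_zero (by fun_prop) 0 r
  have hi2 : IntegrableOn (fun y => (1 / 2) * fderiv ℝ (fderiv ℝ f) x y y) (ball 0 r) :=
    Continuous.integrableOn_ball_zero (by fun_prop) 0 r
  have hi3 : IntegrableOn (fun y : EuclideanSpace ℝ ι => ε / 2 * ‖y‖ ^ 2) (ball 0 r) :=
    Continuous.integrableOn_ball_zero (by fun_prop) 0 r
  have hle : ‖∫ y in ball 0 r, (f (x + y) - f x - fderiv ℝ f x y -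
      (1 / 2) * fderiv ℝ (fderiv ℝ f) x y y)‖ ≤
      ∫ y : EuclideanSpace ℝ ι in ball 0 r, ε / 2 * ‖y‖ ^ 2 := by
    refine norm_integral_le_of_norm_le hi3 ?_
    filter_upwards [ae_restrict_mem measurableSet_ball] with y hy
    have := hball y (ball_subset_ball hr.2.le hy)
    simpa using this
  rw [integral_const_mul, integral_sub (f := fun y => f (x + y) - f x - fderiv ℝ f x y)
    (hint.sub hi1) hi2, integral_sub hint hi1,
    integral_ball_odd (fun y => fderiv ℝ f x y) (fun y => by simp), integral_const_mul, integral_ball_bilin, ← hS, ← hI]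
    at hle
  rw [Real.dist_eq]
  have : (∫ y in ball 0 r, (f (x + y) - f x)) / I - S / (2 * Fintype.card ι) =
     ((∫ y in ball 0 r, (f (x + y) - f x)) - 0 - 1 / 2 * (S / Fintype.card ι * I)) / I := by
    field_simp
    ring
  rw [this, abs_div, abs_of_pos hIpos, div_lt_iff₀ hIpos]
  rw [Real.norm_eq_abs] at hle
  nlinarith

end HasBallLaplacian

theorem laplacian_eq_sum_fderiv (f : EuclideanSpace ℝ ι → ℝ) (x : EuclideanSpace ℝ ι) :
    (Δ f) x = ∑ i, fderiv ℝ (fderiv ℝ f) x (EuclideanSpace.basisFun ι ℝ i)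
      (EuclideanSpace.basisFun ι ℝ i) := by
  rw [InnerProductSpace.laplacian_eq_iteratedFDeriv_orthonormalBasis f
    (EuclideanSpace.basisFun ι ℝ)]
  simp [iteratedFDeriv_two_apply]

end Ball

/-! ### The Bessel power series near zero. -/

/-- For `0 < s < 1` the terms from the second on are `s ^ 2` times a sum bounded by `C`, so the
error of the quotient is at most `C * s`. -/
theorem tendsto_tsum_mul_pow_sub_div {c : ℕ → ℝ} (hc : Summable fun k => |c k|) :
    Tendsto (fun s : ℝ => (∑' k, c k * s ^ k - c 0) / s) (𝓝[>] 0) (𝓝 (c 1)) := by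
  set C := ∑' k, |c (k + 2)| with hC
  have hc2 : Summable fun k => |c (k + 2)| := (summable_nat_add_iff 2).2 hc
  have hlim : Tendsto (fun s : ℝ => C * s) (𝓝[>] 0) (𝓝 0) := by
    have : Continuous fun s : ℝ => C * s := by fun_prop
    simpa using (this.tendsto 0).mono_left nhdsWithin_le_nhds
  rw [tendsto_iff_dist_tendsto_zero]
  refine squeeze_zero' (Eventually.of_forall fun _ => dist_nonneg) ?_ hlim
  filter_upwards [Ioo_mem_nhdsGT (zero_lt_one : (0 : ℝ) < 1)] with s hs
  have hpow : ∀ k, |c k * s ^ k| ≤ |c k| := by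
    intro k
    rw [abs_mul, abs_pow, abs_of_pos hs.1]
    exact mul_le_of_le_one_right (abs_nonneg _) (pow_le_one₀ hs.1.le hs.2.le)
  have hsum : Summable fun k => c k * s ^ k :=
    (Summable.of_nonneg_of_le (fun _ => abs_nonneg _) hpow hc).of_abs
  have hterm : ∀ k, |c (k + 2) * s ^ k| ≤ |c (k + 2)| := by
    intro k
    rw [abs_mul, abs_pow, abs_of_pos hs.1]
    exact mul_le_of_le_one_right (abs_nonneg _) (pow_le_one₀ hs.1.le hs.2.le)
  have hsum3 : Summable fun k => |c (k + 2) * s ^ k| :=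
    Summable.of_nonneg_of_le (fun _ => abs_nonneg _) hterm hc2
  have h1 := hsum.sum_add_tsum_nat_add 2
  have h2 : ∑' k, c (k + 2) * s ^ (k + 2) = s ^ 2 * ∑' k, c (k + 2) * s ^ k := by
    rw [← tsum_mul_left]
    exact tsum_congr fun k => by ring
  rw [h2] at h1
  simp only [Finset.sum_range_succ, Finset.sum_range_zero, pow_zero, pow_one, mul_one,
    zero_add] at h1
  have h3 : (∑' k, c k * s ^ k - c 0) / s - c 1 = s * ∑' k, c (k + 2) * s ^ k := by
    have := hs.1.ne'
    rw [← h1]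
    field_simp
    ring
  rw [Real.dist_eq, h3, abs_mul, abs_of_pos hs.1, mul_comm]
  refine mul_le_mul_of_nonneg_right ?_ hs.1.le
  calc |∑' k, c (k + 2) * s ^ k| ≤ ∑' k, |c (k + 2) * s ^ k| := by
        simpa using norm_tsum_le_tsum_norm (f := fun k => c (k + 2) * s ^ k) (by simpa using hsum3)
    _ ≤ C := hsum3.tsum_le_tsum hterm hc2

/-- The coefficients of the power series of `(z / 2) ^ (-ν) * J_ν(z)` in the variable `z ^ 2 / 4`. -/
def besselCoeff (ν : ℝ) (k : ℕ) : ℝ := (-1) ^ k / ((k.factorial : ℝ) * Real.Gamma (ν + k + 1))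

/-- Gamma increases on `[2, ∞)`, and `1 ≤ ν` places `ν + 1` there; the coefficients are thus
dominated by a multiple of `1 / k!`. -/
theorem summable_abs_besselCoeff {ν : ℝ} (hν : 1 ≤ ν) : Summable fun k => |besselCoeff ν k| := by
  have hG : ∀ k : ℕ, 0 < Real.Gamma (ν + k + 1) := fun k => Real.Gamma_pos_of_pos (by positivity)
  have hG0 : 0 < Real.Gamma (ν + 1) := Real.Gamma_pos_of_pos (by positivity)
  refine Summable.of_nonneg_of_le (fun _ => abs_nonneg _) (fun k => ?_)
    ((Real.summable_pow_div_factorial 1).mul_right (Real.Gamma (ν + 1))⁻¹)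
  have hmono : Real.Gamma (ν + 1) ≤ Real.Gamma (ν + k + 1) := by
    have hk : (0 : ℝ) ≤ k := Nat.cast_nonneg k
    exact Real.Gamma_strictMonoOn_Ici.monotoneOn (by simp; linarith) (by simp; linarith)
      (by linarith)
  rw [besselCoeff, abs_div, abs_pow, abs_neg, abs_one, one_pow,
    abs_of_pos (mul_pos (by positivity) (hG k)), ← div_eq_mul_inv, div_div]
  gcongr

/-- Since `(2πr / lam) * (lam r / 2) = π r ^ 2`, the prefactor absorbs the fractional power in the
Bessel function and leaves a power series in `lam ^ 2 * r ^ 2 / 4`. -/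
theorem rpow_mul_besselJ {m : ℕ} {lam r : ℝ} (hlam : 0 < lam) (hr : 0 < r) :
    (2 * Real.pi * r / lam) ^ ((m : ℝ) / 2) * besselJ ((m : ℝ) / 2) (lam * r) =
      Real.pi ^ ((m : ℝ) / 2) * r ^ m *
        ∑' k, besselCoeff ((m : ℝ) / 2) k * (lam ^ 2 / 4 * r ^ 2) ^ k := by
  have hpi := Real.pi_pos
  have h2 : 0 < lam * r / 2 := by positivity
  have hterm : ∀ k : ℕ, (-1 : ℝ) ^ k / ((k.factorial : ℝ) * Real.Gamma ((m : ℝ) / 2 + (k : ℝ) + 1)) *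
      (lam * r / 2) ^ (2 * (k : ℝ) + (m : ℝ) / 2) =
      (besselCoeff ((m : ℝ) / 2) k * (lam ^ 2 / 4 * r ^ 2) ^ k) *
        (lam * r / 2) ^ ((m : ℝ) / 2) := by
    intro k
    rw [Real.rpow_add h2, Real.rpow_mul h2.le, Real.rpow_natCast]
    have : (lam * r / 2) ^ (2 : ℝ) = lam ^ 2 / 4 * r ^ 2 := by
      rw [show (2 : ℝ) = ((2 : ℕ) : ℝ) by norm_num, Real.rpow_natCast]
      push_cast
      ring
    rw [this, besselCoeff, mul_assoc]
  unfold besselJ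
  rw [tsum_congr hterm, tsum_mul_right]
  have h3 : (2 * Real.pi * r / lam) ^ ((m : ℝ) / 2) * (lam * r / 2) ^ ((m : ℝ) / 2) =
      Real.pi ^ ((m : ℝ) / 2) * r ^ m := by
    rw [← Real.mul_rpow (by positivity) h2.le,
      show 2 * Real.pi * r / lam * (lam * r / 2) = Real.pi * r ^ 2 by field_simp,
      Real.mul_rpow hpi.le (by positivity), ← Real.rpow_natCast r 2, ← Real.rpow_mul hr.le,
      ← Real.rpow_natCast r m]
    congr 2
    push_cast
    ring
  rw [← h3]
  ring

theorem besselCoeff_zero (ν : ℝ) : besselCoeff ν 0 = (Real.Gamma (ν + 1))⁻¹ := by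
  simp [besselCoeff]

theorem besselCoeff_one {ν : ℝ} (hν : 0 < ν) :
    besselCoeff ν 1 = -(besselCoeff ν 0 / (ν + 1)) := by
  have h : Real.Gamma (ν + 1 + 1) = (ν + 1) * Real.Gamma (ν + 1) :=
    Real.Gamma_add_one (by positivity)
  have h0 : 0 < Real.Gamma (ν + 1) := Real.Gamma_pos_of_pos (by positivity)
  rw [besselCoeff_zero, besselCoeff]
  simp [h]
  field_simp

/-! ### From the mean value identity to the generalized Laplacian. -/

section

variable {m : ℕ}

/-- Written with `besselCoeff` so that the volume visibly equals the zeroth term of the series in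
`rpow_mul_besselJ`. -/
theorem volume_real_ball_eq (hm : 0 < m) {r : ℝ} (hr : 0 < r) :
    volume.real (ball (0 : EuclideanSpace ℝ (Fin m)) r) =
      Real.pi ^ ((m : ℝ) / 2) * r ^ m * besselCoeff ((m : ℝ) / 2) 0 := by
  have : Nonempty (Fin m) := ⟨⟨0, hm⟩⟩
  have hG : 0 < Real.Gamma ((m : ℝ) / 2 + 1) := Real.Gamma_pos_of_pos (by positivity)
  rw [measureReal_def, EuclideanSpace.volume_ball, ENNReal.toReal_mul, ENNReal.toReal_pow,
    ENNReal.toReal_ofReal hr.le, Fintype.card_fin, ENNReal.toReal_ofReal (by positivity),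
    besselCoeff_zero, Real.sqrt_eq_rpow, ← Real.rpow_natCast (Real.pi ^ (1 / 2 : ℝ)) m, ← Real.rpow_mul Real.pi_pos.le]
  rw [show 1 / 2 * (m : ℝ) = m / 2 by ring]
  field_simp

theorem integral_ball_norm_sq (hm : 0 < m) {r : ℝ} (hr : 0 < r) :
    ∫ y : EuclideanSpace ℝ (Fin m) in ball 0 r, ‖y‖ ^ 2 =
      Real.pi ^ ((m : ℝ) / 2) * r ^ (m + 2) * besselCoeff ((m : ℝ) / 2) 0 * (m / (m + 2)) := by
  have : Nontrivial (EuclideanSpace ℝ (Fin m)) := by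
    have : Nonempty (Fin m) := ⟨⟨0, hm⟩⟩
    infer_instance
  -- Polar coordinates apply to radial functions on the whole space, so the ball enters as an
  -- indicator of the norm.
  have h := integral_fun_norm_addHaar (volume : Measure (EuclideanSpace ℝ (Fin m)))
    (fun t : ℝ => (Set.Iio r).indicator (fun t => t ^ 2) t)
  have h1 : ∀ y : EuclideanSpace ℝ (Fin m), (Set.Iio r).indicator (fun t => t ^ 2) ‖y‖ =
      (ball (0 : EuclideanSpace ℝ (Fin m)) r).indicator (fun y => ‖y‖ ^ 2) y := by
    intro y
    simp [Set.indicator]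
  simp only [h1] at h
  rw [integral_indicator measurableSet_ball] at h
  rw [h, volume_real_ball_eq hm one_pos]
  have h2 : ∀ t : ℝ, t ^ (Module.finrank ℝ (EuclideanSpace ℝ (Fin m)) - 1) •
      (Set.Iio r).indicator (fun t => t ^ 2) t =
      (Set.Iio r).indicator (fun t => t ^ (m + 1)) t := by
    intro t
    by_cases ht : t < r
    · simp only [finrank_euclideanSpace, Fintype.card_fin, Set.mem_Iio, ht,
        Set.indicator_of_mem, smul_eq_mul, ← pow_add]
      congr 1
      omega
    · simp [ht]
  simp only [h2]
  rw [setIntegral_indicator measurableSet_Iio, Set.Ioi_inter_Iio,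
    ← integral_Ioc_eq_integral_Ioo, ← intervalIntegral.integral_of_le hr.le, integral_pow]
  simp
  field_simp
  ring_nf

theorem hasBallLaplacian_of_mean_value (hm : 2 ≤ m) {D : Set (EuclideanSpace ℝ (Fin m))}
    {u : EuclideanSpace ℝ (Fin m) → ℝ} (hu : ContinuousOn u D) {lam : ℝ} (hlam : 0 < lam)
    {x : EuclideanSpace ℝ (Fin m)} (hD : D ∈ 𝓝 x) {R : ℝ} (hR : 0 < R)
    (hmean : ∀ r : ℝ, 0 < r → r < R →
      (2 * Real.pi * r / lam) ^ ((m : ℝ) / 2) * besselJ ((m : ℝ) / 2) (lam * r) * u x =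
        ∫ y in Metric.ball (0 : EuclideanSpace ℝ (Fin m)) r, u (x + y)) :
    HasBallLaplacian u x (-lam ^ 2 * u x) := by
  have hm0 : 0 < m := by omega
  have hmR : (2 : ℝ) ≤ m := by exact_mod_cast hm
  have hpi : 0 < Real.pi ^ ((m : ℝ) / 2) := Real.rpow_pos_of_pos Real.pi_pos _
  set ν := (m : ℝ) / 2 with hν
  have hc0 : 0 < besselCoeff ν 0 := by
    rw [besselCoeff_zero]
    exact inv_pos.2 (Real.Gamma_pos_of_pos (by positivity))
  have hs : Tendsto (fun r : ℝ => lam ^ 2 / 4 * r ^ 2) (𝓝[>] 0) (𝓝[>] 0) := by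
    refine tendsto_nhdsWithin_iff.2 ⟨?_, ?_⟩
    · have : Continuous fun r : ℝ => lam ^ 2 / 4 * r ^ 2 := by fun_prop
      simpa using (this.tendsto 0).mono_left nhdsWithin_le_nhds
    · filter_upwards [self_mem_nhdsWithin] with r hr
      have : 0 < r := hr
      simp only [Set.mem_Ioi]
      positivity
  -- The quotient is taken in `s = lam ^ 2 / 4 * r ^ 2`; the constant factor turns division by `s`
  -- into division by the integral of `‖y‖ ^ 2`, after cancelling `π ^ (m / 2) * r ^ m`.
  have h := ((tendsto_tsum_mul_pow_sub_div
    (summable_abs_besselCoeff (ν := ν) (by rw [hν]; linarith))).comp hs).mul_const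
    (lam ^ 2 / 4 / (besselCoeff ν 0 * (m / (m + 2))) * u x)
  rw [HasBallLaplacian]
  have hval : besselCoeff ν 1 * (lam ^ 2 / 4 / (besselCoeff ν 0 * (m / (m + 2))) * u x) =
      -lam ^ 2 * u x / (2 * Fintype.card (Fin m)) := by
    rw [besselCoeff_one (by positivity), Fintype.card_fin, show (m : ℝ) = 2 * ν by rw [hν]; ring]
    have hν0 : 0 < ν := by positivity
    have hν1 : 2 * ν + 2 ≠ 0 := by positivity
    generalize besselCoeff ν 0 = c at hc0
    field_simp
    ring
  rw [hval] at h
  refine h.congr' ?_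
  filter_upwards [Ioo_mem_nhdsGT hR, HasBallLaplacian.eventually_integrableOn hu hD] with r hr hint
  have h2 : ∫ y in ball (0 : EuclideanSpace ℝ (Fin m)) r, u (x + y) =
      (∫ y in ball (0 : EuclideanSpace ℝ (Fin m)) r, (u (x + y) - u x)) +
        volume.real (ball (0 : EuclideanSpace ℝ (Fin m)) r) * u x := by
    have hcst : IntegrableOn (fun _ : EuclideanSpace ℝ (Fin m) => u x) (ball 0 r) :=
      Continuous.integrableOn_ball_zero continuous_const 0 r
    have := integral_add hint hcst
    simp only [sub_add_cancel] at this
    rw [this]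
    simp
  have h3 := hmean r hr.1 hr.2
  rw [h2, rpow_mul_besselJ hlam hr.1, volume_real_ball_eq hm0 hr.1] at h3
  rw [← sub_eq_iff_eq_add] at h3
  rw [← h3, integral_ball_norm_sq hm0 hr.1]
  have := hr.1
  simp only [Function.comp]
  rw [← hν]
  field_simp
  ring

end

/-! ### Harmonic polynomials: maximum principle and density on spheres. -/

section HarmonicPolynomial

variable {ι : Type*} [Fintype ι]

/-- If `f + ε‖·‖²` never has an interior local maximum, then `f` is bounded on a closed ball by its
supremum on the sphere. -/
theorem le_of_forall_not_isLocalMax {f : EuclideanSpace ℝ ι → ℝ} {ρ M : ℝ}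
    (hρ : 0 < ρ) (hf : ContinuousOn f (closedBall 0 ρ)) (hb : ∀ z ∈ sphere 0 ρ, f z ≤ M)
    (hno : ∀ ε > 0, ∀ z ∈ ball 0 ρ, ¬ IsLocalMax (fun z => f z + ε * ‖z‖ ^ 2) z) :
    ∀ z ∈ closedBall 0 ρ, f z ≤ M := by
  intro z hz
  refine le_of_forall_pos_le_add fun δ hδ => ?_
  -- With this choice the perturbation `ε * ‖z‖ ^ 2` equals `δ` on the sphere.
  have hε : 0 < δ / ρ ^ 2 := by positivity
  set ε := δ / ρ ^ 2
  have hcont : ContinuousOn (fun z => f z + ε * ‖z‖ ^ 2) (closedBall 0 ρ) :=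
    hf.add (by fun_prop)
  obtain ⟨w, hw, hmax⟩ := (isCompact_closedBall (0 : EuclideanSpace ℝ ι) ρ).exists_isMaxOn
    ⟨z, hz⟩ hcont
  have hws : w ∈ sphere 0 ρ := by
    rw [← closedBall_sdiff_ball]
    refine ⟨hw, fun hwb => hno ε hε w hwb ?_⟩
    exact hmax.isLocalMax (mem_of_superset (isOpen_ball.mem_nhds hwb) ball_subset_closedBall)
  have h1 : f z + ε * ‖z‖ ^ 2 ≤ f w + ε * ‖w‖ ^ 2 := hmax hz
  rw [mem_sphere_zero_iff_norm.1 hws] at h1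
  have h2 : ε * ρ ^ 2 = δ := by simp only [ε]; field_simp
  have h3 : 0 ≤ ε * ‖z‖ ^ 2 := by positivity
  linarith [hb w hws]

/-- The polynomial function on Euclidean space defined by a multivariate polynomial. -/
def evalEuclidean (P : MvPolynomial ι ℝ) (x : EuclideanSpace ℝ ι) : ℝ :=
  MvPolynomial.eval x.ofLp P

theorem contDiff_evalEuclidean (P : MvPolynomial ι ℝ) {n : WithTop ℕ∞} :
    ContDiff ℝ n (evalEuclidean P) := by
  induction P using MvPolynomial.induction_on with
  | C a =>
    have : evalEuclidean (MvPolynomial.C a : MvPolynomial ι ℝ) = fun _ => a := by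
      ext; simp [evalEuclidean]
    exact this ▸ contDiff_const
  | add p q hp hq =>
    have : evalEuclidean (p + q) = fun x => evalEuclidean p x + evalEuclidean q x := by
      ext; simp [evalEuclidean]
    exact this ▸ ContDiff.add hp hq
  | mul_X p i hp =>
    have hX : ContDiff ℝ n fun x : EuclideanSpace ℝ ι => x i := by fun_prop
    have : evalEuclidean (p * MvPolynomial.X i) = fun x => evalEuclidean p x * x i := by
      ext; simp [evalEuclidean]
    exact this ▸ ContDiff.mul hp hX

theorem fderiv_evalEuclidean_basisFun (P : MvPolynomial ι ℝ) (x : EuclideanSpace ℝ ι) (i : ι) :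
    fderiv ℝ (evalEuclidean P) x (EuclideanSpace.basisFun ι ℝ i) =
      evalEuclidean (MvPolynomial.pderiv i P) x := by
  classical
  have hd : ∀ p : MvPolynomial ι ℝ, DifferentiableAt ℝ (evalEuclidean p) x :=
    fun p => (contDiff_evalEuclidean p (n := 1)).differentiable (by norm_num) x
  induction P using MvPolynomial.induction_on with
  | C a =>
    have : evalEuclidean (MvPolynomial.C a : MvPolynomial ι ℝ) = fun _ => a := by
      ext; simp [evalEuclidean]
    rw [this]
    simp [evalEuclidean]
  | add p q hp hq =>
    have : evalEuclidean (p + q) = evalEuclidean p + evalEuclidean q := by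
      ext; simp [evalEuclidean]
    rw [this, fderiv_add (hd p) (hd q), add_apply, hp, hq]
    simp [evalEuclidean]
  | mul_X p j hp =>
    have : evalEuclidean (p * MvPolynomial.X j) =
        evalEuclidean p * ⇑(EuclideanSpace.proj j : EuclideanSpace ℝ ι →L[ℝ] ℝ) := by
      ext; simp [evalEuclidean]
    rw [this, fderiv_mul (hd p) (ContinuousLinearMap.differentiableAt _), add_apply, smul_apply,
      smul_apply, hp, ContinuousLinearMap.fderiv]
    simp only [EuclideanSpace.basisFun_apply, PiLp.proj_apply, smul_eq_mul,
      evalEuclidean, Derivation.leibniz, map_add, map_mul, MvPolynomial.eval_X,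
      MvPolynomial.pderiv_X, PiLp.single_apply, Pi.single_apply]
    by_cases hij : j = i
    · subst hij; simp
    · simp [hij]

/-- The Laplace operator on multivariate polynomials. -/
def polyLaplacian : MvPolynomial ι ℝ →ₗ[ℝ] MvPolynomial ι ℝ :=
  ∑ i, (MvPolynomial.pderiv i).toLinearMap ∘ₗ (MvPolynomial.pderiv i).toLinearMap

theorem fderiv_fderiv_evalEuclidean_basisFun (P : MvPolynomial ι ℝ) (x : EuclideanSpace ℝ ι)
    (i : ι) : fderiv ℝ (fderiv ℝ (evalEuclidean P)) x (EuclideanSpace.basisFun ι ℝ i)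
      (EuclideanSpace.basisFun ι ℝ i) =
      evalEuclidean (MvPolynomial.pderiv i (MvPolynomial.pderiv i P)) x := by
  have h : evalEuclidean (MvPolynomial.pderiv i P) =
      fun x => fderiv ℝ (evalEuclidean P) x (EuclideanSpace.basisFun ι ℝ i) :=
    funext fun x => (fderiv_evalEuclidean_basisFun P x i).symm
  have hd : DifferentiableAt ℝ (fderiv ℝ (evalEuclidean P)) x :=
    ((contDiff_evalEuclidean P (n := 2)).fderiv_right (m := 1) (by norm_num)).differentiable
      (by norm_num) x
  rw [← fderiv_evalEuclidean_basisFun, h, fderiv_clm_apply hd (by fun_prop)]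
  simp

theorem sum_fderiv_evalEuclidean (P : MvPolynomial ι ℝ) (x : EuclideanSpace ℝ ι) :
    ∑ i, fderiv ℝ (fderiv ℝ (evalEuclidean P)) x (EuclideanSpace.basisFun ι ℝ i)
      (EuclideanSpace.basisFun ι ℝ i) = evalEuclidean (polyLaplacian P) x := by
  simp only [fderiv_fderiv_evalEuclidean_basisFun, evalEuclidean, polyLaplacian,
    LinearMap.sum_apply, map_sum, LinearMap.comp_apply, Derivation.coeFn_coe]

/-- The polynomial `∑ Xᵢ²`. -/
def polyNormSq (ι : Type*) [Fintype ι] : MvPolynomial ι ℝ := ∑ i, MvPolynomial.X i ^ 2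

theorem evalEuclidean_polyNormSq (x : EuclideanSpace ℝ ι) :
    evalEuclidean (polyNormSq ι) x = ‖x‖ ^ 2 := by
  simp [evalEuclidean, polyNormSq, EuclideanSpace.real_norm_sq_eq]

theorem polyLaplacian_polyNormSq :
    polyLaplacian (polyNormSq ι) = MvPolynomial.C (2 * Fintype.card ι : ℝ) := by
  classical
  have h : ∀ i j : ι, MvPolynomial.pderiv i (MvPolynomial.pderiv i
      (MvPolynomial.X j ^ 2 : MvPolynomial ι ℝ)) =
      if j = i then MvPolynomial.C 2 else 0 := by
    intro i j
    by_cases hij : j = i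
    · subst hij
      simp [sq, one_add_one_eq_two, map_ofNat]
    · simp [MvPolynomial.pderiv_X_of_ne hij, hij]
  simp only [polyLaplacian, polyNormSq, map_sum, LinearMap.sum_apply, LinearMap.comp_apply,
    Derivation.coeFn_coe, h]
  simp [mul_comm]

theorem totalDegree_pderiv_le {σ : Type*} (P : MvPolynomial σ ℝ) (i : σ) :
    (MvPolynomial.pderiv i P).totalDegree ≤ P.totalDegree - 1 := by
  refine Finset.sup_le fun d hd => ?_
  rw [MvPolynomial.mem_support_iff, MvPolynomial.coeff_pderiv] at hd
  have h := MvPolynomial.le_totalDegree (MvPolynomial.mem_support_iff.2 (left_ne_zero_of_mul hd))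
  rw [Finsupp.sum_add_index' (by simp) (by simp)] at h
  simp at h
  omega

theorem totalDegree_polyLaplacian_le {P : MvPolynomial ι ℝ} {k : ℕ} (hP : P.totalDegree ≤ k + 2) :
    (polyLaplacian P).totalDegree ≤ k := by
  simp only [polyLaplacian, LinearMap.sum_apply, LinearMap.comp_apply, Derivation.coeFn_coe]
  refine (MvPolynomial.totalDegree_finsetSum_le fun i _ => ?_)
  have h1 := totalDegree_pderiv_le P i
  have h2 := totalDegree_pderiv_le (MvPolynomial.pderiv i P) i
  omega

theorem totalDegree_polyNormSq_le : (polyNormSq ι).totalDegree ≤ 2 :=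
  MvPolynomial.totalDegree_finsetSum_le fun i _ => by
    simp

/-- Adding `ε * ‖z‖ ^ 2` makes the Laplacian the positive constant `2 * n * ε`, which excludes local
maxima. -/
theorem evalEuclidean_le_zero_of_sphere [Nonempty ι] {P : MvPolynomial ι ℝ}
    (hP : polyLaplacian P = 0) {ρ : ℝ} (hρ : 0 < ρ) (hb : ∀ z ∈ sphere 0 ρ, evalEuclidean P z ≤ 0) :
    ∀ z ∈ closedBall 0 ρ, evalEuclidean P z ≤ 0 := by
  refine le_of_forall_not_isLocalMax hρ
    (contDiff_evalEuclidean P (n := 0)).continuous.continuousOn hb fun ε hε z _ hmax => ?_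
  have h1 : (fun z => evalEuclidean P z + ε * ‖z‖ ^ 2) =
      evalEuclidean (P + ε • polyNormSq ι) := by
    ext z
    rw [← evalEuclidean_polyNormSq]
    simp [evalEuclidean, MvPolynomial.smul_eval]
  rw [h1] at hmax
  have h2 := (HasBallLaplacian.of_contDiffAt
    (contDiff_evalEuclidean (P + ε • polyNormSq ι) (n := 2)).contDiffAt).nonpos_of_isLocalMax hmax
  rw [sum_fderiv_evalEuclidean, map_add, map_smul, hP, polyLaplacian_polyNormSq] at h2
  have hn : (0 : ℝ) < Fintype.card ι := by exact_mod_cast Fintype.card_pos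
  have : 0 < ε * (2 * Fintype.card ι) := by positivity
  simp only [evalEuclidean, zero_add, MvPolynomial.smul_eval, MvPolynomial.eval_C] at h2
  linarith

/-- The Euclidean ball contains a sup-norm ball, a product of infinite sets, on which a nonzero
polynomial cannot vanish. -/
theorem eq_zero_of_evalEuclidean_eq_zero_on_ball {P : MvPolynomial ι ℝ} {ρ : ℝ} (hρ : 0 < ρ)
    (h : ∀ z ∈ ball 0 ρ, evalEuclidean P z = 0) : P = 0 := by
  have hc : Continuous fun x : ι → ℝ => (WithLp.toLp 2 x : EuclideanSpace ℝ ι) :=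
    PiLp.continuous_toLp 2 _
  have hn : (fun x : ι → ℝ => (WithLp.toLp 2 x : EuclideanSpace ℝ ι)) ⁻¹' ball 0 ρ ∈
      𝓝 (0 : ι → ℝ) := hc.continuousAt.preimage_mem_nhds (by simpa using ball_mem_nhds _ hρ)
  obtain ⟨ε, hε, hsub⟩ := Metric.mem_nhds_iff.1 hn
  refine MvPolynomial.funext_set (fun _ => ball (0 : ℝ) ε) (fun _ => ?_) fun x hx => ?_
  · rw [Real.ball_eq_Ioo]
    exact Set.Ioo_infinite (by linarith)
  · rw [← ball_pi _ hε] at hx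
    have := h _ (hsub hx)
    simpa [evalEuclidean] using this

/-- On a sphere every polynomial coincides with a harmonic polynomial. -/
theorem exists_harmonic_polynomial_eq_on_sphere [Nonempty ι] (P : MvPolynomial ι ℝ) {ρ : ℝ}
    (hρ : 0 < ρ) : ∃ H : MvPolynomial ι ℝ, polyLaplacian H = 0 ∧
      ∀ z ∈ sphere 0 ρ, evalEuclidean H z = evalEuclidean P z := by
  set k := P.totalDegree
  -- `W` vanishes on the sphere, so it suffices to find `q` with `Δ (W q) = Δ P` and take `H = P - W
  -- q`.
  set W : MvPolynomial ι ℝ := MvPolynomial.C (ρ ^ 2) - polyNormSq ι with hW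
  have hWdeg : W.totalDegree ≤ 2 := by
    refine (MvPolynomial.totalDegree_sub _ _).trans ?_
    rw [MvPolynomial.totalDegree_C]
    simpa using totalDegree_polyNormSq_le (ι := ι)
  have hWeval : ∀ z, evalEuclidean W z = ρ ^ 2 - ‖z‖ ^ 2 := by
    intro z
    rw [← evalEuclidean_polyNormSq]
    simp [hW, evalEuclidean]
  let T : MvPolynomial ι ℝ →ₗ[ℝ] MvPolynomial ι ℝ := polyLaplacian ∘ₗ LinearMap.mulLeft ℝ W
  -- Multiplication by `W` raises the degree by at most two and the Laplacian lowers it by two, so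
  -- `T` acts on a finite-dimensional space, where injectivity gives surjectivity.
  have hT : ∀ q ∈ MvPolynomial.restrictTotalDegree ι ℝ k,
      T q ∈ MvPolynomial.restrictTotalDegree ι ℝ k := by
    intro q hq
    rw [MvPolynomial.mem_restrictTotalDegree] at hq ⊢
    refine totalDegree_polyLaplacian_le ?_
    simp only [LinearMap.mulLeft_apply]
    exact (MvPolynomial.totalDegree_mul _ _).trans (by omega)
  -- If `W q` is harmonic, the maximum principle for `±W q` forces it to vanish in the ball, where
  -- `W` is positive.
  have hinj : ∀ q : MvPolynomial ι ℝ, T q = 0 → q = 0 := by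
    intro q hq
    have h1 : polyLaplacian (W * q) = 0 := hq
    have h2 : polyLaplacian (-(W * q)) = 0 := by rw [map_neg, h1, neg_zero]
    have hs : ∀ z ∈ sphere 0 ρ, evalEuclidean (W * q) z = 0 := by
      intro z hz
      have := hWeval z
      rw [mem_sphere_zero_iff_norm.1 hz, sub_self] at this
      simp only [evalEuclidean] at this
      simp [evalEuclidean, this]
    have hs' : ∀ z ∈ sphere 0 ρ, evalEuclidean (-(W * q)) z ≤ 0 := by
      intro z hz
      have := hs z hz
      simp only [evalEuclidean, map_neg] at this ⊢
      linarith
    refine eq_zero_of_evalEuclidean_eq_zero_on_ball hρ fun z hz => ?_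
    have h3 := evalEuclidean_le_zero_of_sphere h1 hρ (fun z hz => (hs z hz).le) z
      (ball_subset_closedBall hz)
    have h4 := evalEuclidean_le_zero_of_sphere h2 hρ hs' z (ball_subset_closedBall hz)
    have h5 : evalEuclidean W z * evalEuclidean q z = 0 := by
      simp only [evalEuclidean, map_neg, map_mul] at h3 h4 ⊢
      linarith
    rcases mul_eq_zero.1 h5 with h | h
    · rw [hWeval] at h
      rw [mem_ball_zero_iff] at hz
      have := norm_nonneg z
      nlinarith
    · exact h
  have hTinj : Function.Injective (T.restrict hT) := by
    rw [injective_iff_map_eq_zero]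
    intro q hq
    have : T q = 0 := by exact congrArg Subtype.val hq
    exact Subtype.ext (hinj q this)
  have hTsurj := LinearMap.injective_iff_surjective.1 hTinj
  obtain ⟨q, hq⟩ := hTsurj ⟨polyLaplacian P, by
    rw [MvPolynomial.mem_restrictTotalDegree]
    exact totalDegree_polyLaplacian_le (by omega)⟩
  have hq' : polyLaplacian (W * q.1) = polyLaplacian P := congrArg Subtype.val hq
  refine ⟨P - W * q.1, by rw [map_sub, hq', sub_self], fun z hz => ?_⟩
  have := hWeval z
  rw [mem_sphere_zero_iff_norm.1 hz, sub_self] at this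
  simp only [evalEuclidean] at this
  simp [evalEuclidean, this]

/-- Harmonic polynomials are uniformly dense in the continuous functions on a sphere. -/
theorem exists_harmonic_polynomial_near [Nonempty ι] {f : EuclideanSpace ℝ ι → ℝ} {ρ : ℝ}
    (hρ : 0 < ρ) (hf : ContinuousOn f (sphere 0 ρ)) {ε : ℝ} (hε : 0 < ε) :
    ∃ H : MvPolynomial ι ℝ, polyLaplacian H = 0 ∧
      ∀ z ∈ sphere 0 ρ, |evalEuclidean H z - f z| < ε := by
  -- Stone–Weierstrass is applied to the range of this map, the algebra of polynomials restricted to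
  -- the sphere.
  let Φ : MvPolynomial ι ℝ →ₐ[ℝ] C(sphere (0 : EuclideanSpace ℝ ι) ρ, ℝ) :=
    MvPolynomial.aeval fun i => ⟨fun z => z.1 i, by fun_prop⟩
  have hΦ : ∀ P z, Φ P z = evalEuclidean P z.1 := by
    intro P z
    have : (ContinuousMap.evalAlgHom ℝ ℝ z).comp Φ = MvPolynomial.aeval z.1.ofLp := by
      ext i
      simp [Φ]
    have h := DFunLike.congr_fun this P
    simpa [evalEuclidean, MvPolynomial.aeval_eq_eval] using h
  have hsep : Φ.range.SeparatesPoints := by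
    intro z w hzw
    have : ∃ i, z.1 i ≠ w.1 i := by
      by_contra! h
      exact hzw (Subtype.ext (PiLp.ext h))
    obtain ⟨i, hi⟩ := this
    exact ⟨_, ⟨Φ (MvPolynomial.X i), ⟨_, rfl⟩, rfl⟩, by simpa [Φ] using hi⟩
  have : CompactSpace (sphere (0 : EuclideanSpace ℝ ι) ρ) :=
    isCompact_iff_compactSpace.1 (isCompact_sphere 0 ρ)
  obtain ⟨⟨_, P, rfl⟩, hP⟩ :=
    ContinuousMap.exists_mem_subalgebra_near_continuous_of_separatesPoints Φ.range hsep
      (fun z => f z.1) (continuousOn_iff_continuous_domRestrict.1 hf) ε hε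
  obtain ⟨H, hH, hHP⟩ := exists_harmonic_polynomial_eq_on_sphere P hρ
  refine ⟨H, hH, fun z hz => ?_⟩
  rw [hHP z hz]
  have := hP ⟨z, hz⟩
  simpa [hΦ] using this

end HarmonicPolynomial

/-! ### Radial mollification and smoothness of uniform limits. -/

section Mollifier

variable {ι : Type*} [Fintype ι]

theorem deriv_expNegInvGlue (x : ℝ) : deriv expNegInvGlue x = x⁻¹ ^ 2 * expNegInvGlue x := by
  have := expNegInvGlue.hasDerivAt_polynomial_eval_inv_mul 1 x
  simp only [Polynomial.eval_one, one_mul] at this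
  rw [this.deriv]
  simp

theorem contDiff_deriv_expNegInvGlue {n : ℕ∞} : ContDiff ℝ n (deriv expNegInvGlue) := by
  have h : ContDiff ℝ ((⊤ : ℕ∞) : WithTop ℕ∞) expNegInvGlue := expNegInvGlue.contDiff
  exact ((contDiff_infty_iff_deriv.1 h).2).of_le (by exact_mod_cast le_top)

/-- The radial cutoff `exp(-1/(δ² - ‖y‖²))` supported in the ball of radius `δ`. -/
def radialCutoff (δ : ℝ) (y : EuclideanSpace ℝ ι) : ℝ := expNegInvGlue (δ ^ 2 - ‖y‖ ^ 2)

/-- A smooth nonnegative radial kernel `k`, with `2 y k(y) = -∇ radialCutoff(y)`. -/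
def radialKernel (δ : ℝ) (y : EuclideanSpace ℝ ι) : ℝ := deriv expNegInvGlue (δ ^ 2 - ‖y‖ ^ 2)

theorem contDiff_radialCutoff (δ : ℝ) {n : ℕ∞} :
    ContDiff ℝ n (radialCutoff δ : EuclideanSpace ℝ ι → ℝ) :=
  expNegInvGlue.contDiff.comp (contDiff_const.sub (contDiff_norm_sq ℝ))

theorem contDiff_radialKernel (δ : ℝ) {n : ℕ∞} :
    ContDiff ℝ n (radialKernel δ : EuclideanSpace ℝ ι → ℝ) :=
  contDiff_deriv_expNegInvGlue.comp (contDiff_const.sub (contDiff_norm_sq ℝ))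

theorem continuous_radialKernel (δ : ℝ) :
    Continuous (radialKernel δ : EuclideanSpace ℝ ι → ℝ) :=
  (contDiff_radialKernel δ (n := 0)).continuous

theorem continuous_radialCutoff (δ : ℝ) :
    Continuous (radialCutoff δ : EuclideanSpace ℝ ι → ℝ) :=
  (contDiff_radialCutoff δ (n := 0)).continuous

theorem radialCutoff_eq_zero {δ : ℝ} (hδ : 0 < δ) {y : EuclideanSpace ℝ ι} (hy : δ ≤ ‖y‖) :
    radialCutoff δ y = 0 :=
  expNegInvGlue.zero_of_nonpos (by nlinarith)

theorem radialKernel_eq_zero {δ : ℝ} (hδ : 0 < δ) {y : EuclideanSpace ℝ ι} (hy : δ ≤ ‖y‖) :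
    radialKernel δ y = 0 := by
  rw [radialKernel, deriv_expNegInvGlue, expNegInvGlue.zero_of_nonpos (by nlinarith), mul_zero]

theorem radialKernel_nonneg (δ : ℝ) (y : EuclideanSpace ℝ ι) : 0 ≤ radialKernel δ y := by
  rw [radialKernel, deriv_expNegInvGlue]
  exact mul_nonneg (by positivity) (expNegInvGlue.nonneg _)

theorem hasCompactSupport_radialCutoff {δ : ℝ} (hδ : 0 < δ) :
    HasCompactSupport (radialCutoff δ : EuclideanSpace ℝ ι → ℝ) :=
  HasCompactSupport.intro (isCompact_closedBall 0 δ) fun y hy =>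
    radialCutoff_eq_zero hδ (by simpa using (not_le.1 fun h => hy (by simpa using h)).le)

theorem hasCompactSupport_radialKernel {δ : ℝ} (hδ : 0 < δ) :
    HasCompactSupport (radialKernel δ : EuclideanSpace ℝ ι → ℝ) :=
  HasCompactSupport.intro (isCompact_closedBall 0 δ) fun y hy =>
    radialKernel_eq_zero hδ (by simpa using (not_le.1 fun h => hy (by simpa using h)).le)

theorem integral_radialKernel_pos {δ : ℝ} (hδ : 0 < δ) :
    0 < ∫ y : EuclideanSpace ℝ ι, radialKernel δ y := by
  refine (continuous_radialKernel δ).integral_pos_of_hasCompactSupport_nonneg_nonzero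
    (hasCompactSupport_radialKernel hδ) (radialKernel_nonneg δ) (x := 0) ?_
  rw [radialKernel, deriv_expNegInvGlue]
  have h : 0 < δ ^ 2 - ‖(0 : EuclideanSpace ℝ ι)‖ ^ 2 := by simpa using pow_pos hδ 2
  have := expNegInvGlue.pos_of_pos h
  positivity

theorem fderiv_radialCutoff_basisFun (δ : ℝ) (y : EuclideanSpace ℝ ι) (i : ι) :
    fderiv ℝ (radialCutoff δ) y (EuclideanSpace.basisFun ι ℝ i) =
      -(2 * (radialKernel δ y * y i)) := by
  classical
  have h1 : HasFDerivAt (fun y : EuclideanSpace ℝ ι => δ ^ 2 - ‖y‖ ^ 2) (-(2 • innerSL ℝ y)) y :=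
    (hasStrictFDerivAt_norm_sq y).hasFDerivAt.const_sub (δ ^ 2)
  have h2 : HasDerivAt expNegInvGlue (radialKernel δ y) (δ ^ 2 - ‖y‖ ^ 2) :=
    ((expNegInvGlue.contDiff (n := 1)).differentiable (by norm_num) _).hasDerivAt
  have h3 : HasFDerivAt (radialCutoff δ) (radialKernel δ y • (-(2 • innerSL ℝ y) :
      EuclideanSpace ℝ ι →L[ℝ] ℝ)) y :=
    h2.comp_hasFDerivAt y h1
  rw [h3.fderiv]
  simp [EuclideanSpace.inner_single_right]
  ring

theorem fderiv_evalEuclidean_apply (P : MvPolynomial ι ℝ) (x y : EuclideanSpace ℝ ι) :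
    fderiv ℝ (evalEuclidean P) x y = ∑ i, y i * evalEuclidean (MvPolynomial.pderiv i P) x := by
  have hy : y = ∑ i, y i • EuclideanSpace.basisFun ι ℝ i := by
    simpa using ((EuclideanSpace.basisFun ι ℝ).sum_repr y).symm
  conv_lhs => rw [hy]
  simp only [map_sum, map_smul, smul_eq_mul, fderiv_evalEuclidean_basisFun]

theorem continuous_evalEuclidean (P : MvPolynomial ι ℝ) : Continuous (evalEuclidean P) :=
  (contDiff_evalEuclidean P (n := 0)).continuous

/-- Integration by parts: `radialKernel δ y * y i` is `-1 / 2` times the `i`-th derivative of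
`radialCutoff δ`, and the chain rule produces `s`. -/
theorem integral_radialKernel_coord_mul {δ : ℝ} (hδ : 0 < δ) (P : MvPolynomial ι ℝ)
    (x : EuclideanSpace ℝ ι) (s : ℝ) (i : ι) :
    ∫ y, radialKernel δ y * (y i * evalEuclidean P (x + s • y)) =
      s / 2 * ∫ y, radialCutoff δ y * evalEuclidean (MvPolynomial.pderiv i P) (x + s • y) := by
  set g : EuclideanSpace ℝ ι → ℝ := fun y => evalEuclidean P (x + s • y) with hg
  have hgc : Continuous g := (continuous_evalEuclidean P).comp (by fun_prop)
  have hgd : ∀ y, fderiv ℝ g y (EuclideanSpace.basisFun ι ℝ i) =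
      s * evalEuclidean (MvPolynomial.pderiv i P) (x + s • y) := by
    intro y
    have h1 : HasFDerivAt (fun y : EuclideanSpace ℝ ι => x + s • y)
        (s • ContinuousLinearMap.id ℝ (EuclideanSpace ℝ ι)) y :=
      ((hasFDerivAt_id y).const_smul s).const_add x
    have h2 : HasFDerivAt g _ y := (((contDiff_evalEuclidean P (n := 1)).differentiable
      (by norm_num) _).hasFDerivAt).comp y h1
    rw [h2.fderiv]
    simp only [ContinuousLinearMap.comp_apply, smul_apply, ContinuousLinearMap.id_apply,
      map_smul, smul_eq_mul, fderiv_evalEuclidean_basisFun]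
  have hgdiff : Differentiable ℝ g := ((contDiff_evalEuclidean P (n := 1)).comp
    (by fun_prop : ContDiff ℝ 1 fun y : EuclideanSpace ℝ ι => x + s • y)).differentiable
      (by norm_num)
  have hcp : Continuous fun y => s * evalEuclidean (MvPolynomial.pderiv i P) (x + s • y) :=
    continuous_const.mul ((continuous_evalEuclidean _).comp (by fun_prop))
  have hΦ := continuous_radialCutoff (ι := ι) δ
  have hk := continuous_radialKernel (ι := ι) δ
  have hibp := integral_mul_fderiv_eq_neg_fderiv_mul_of_integrable (μ := volume)
    (f := radialCutoff δ) (g := g) (v := EuclideanSpace.basisFun ι ℝ i)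
    (by
      simp only [fderiv_radialCutoff_basisFun]
      refine Continuous.integrable_of_hasCompactSupport (by fun_prop) ?_
      refine HasCompactSupport.mono (hasCompactSupport_radialKernel hδ) fun y hy => ?_
      rw [Function.mem_support] at hy ⊢
      intro h0
      exact hy (by simp [h0]))
    (by
      simp only [hgd]
      exact (hΦ.mul hcp).integrable_of_hasCompactSupport
        (hasCompactSupport_radialCutoff hδ).mul_right)
    ((hΦ.mul hgc).integrable_of_hasCompactSupport (hasCompactSupport_radialCutoff hδ).mul_right)
    (fun y _ => (contDiff_radialCutoff δ (n := 1)).differentiable (by norm_num) y)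
    (fun y _ => hgdiff y)
  simp only [hgd, fderiv_radialCutoff_basisFun] at hibp
  have e1 : ∀ y, radialCutoff δ y * (s * evalEuclidean (MvPolynomial.pderiv i P) (x + s • y)) =
      s * (radialCutoff δ y * evalEuclidean (MvPolynomial.pderiv i P) (x + s • y)) :=
    fun y => by ring
  have e2 : ∀ y, -(2 * (radialKernel δ y * y i)) * g y =
      (-2) * (radialKernel δ y * (y i * evalEuclidean P (x + s • y))) :=
    fun y => by simp only [hg]; ring
  simp only [e1, e2, integral_const_mul] at hibp
  linarith

/-- Mean value property of harmonic polynomials with respect to the radial kernel. -/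
theorem integral_radialKernel_mul_evalEuclidean {δ : ℝ} (hδ : 0 < δ) {H : MvPolynomial ι ℝ}
    (hH : polyLaplacian H = 0) (x : EuclideanSpace ℝ ι) :
    ∫ y, radialKernel δ y * evalEuclidean H (x - y) =
      (∫ y : EuclideanSpace ℝ ι, radialKernel δ y) * evalEuclidean H x := by
  have hk := continuous_radialKernel (ι := ι) δ
  have hks := hasCompactSupport_radialKernel (ι := ι) hδ
  have hHc := continuous_evalEuclidean H
  have hHd : Continuous (fderiv ℝ (evalEuclidean H)) :=
    (contDiff_evalEuclidean H (n := 1)).continuous_fderiv (by norm_num)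
  have hcF : ∀ s : ℝ, Continuous fun y => radialKernel δ y * evalEuclidean H (x + s • y) :=
    fun s => by fun_prop
  have hcF' : ∀ s : ℝ, Continuous fun y =>
      radialKernel δ y * fderiv ℝ (evalEuclidean H) (x + s • y) y :=
    fun s => hk.mul ((hHd.comp (by fun_prop)).clm_apply continuous_id)
  -- Differentiating under the integral and integrating by parts gives `s / 2` times the integral of
  -- `radialCutoff δ` against the Laplacian of `H`, which is zero.
  have hderiv : ∀ s : ℝ, HasDerivAt
      (fun s : ℝ => ∫ y, radialKernel δ y * evalEuclidean H (x + s • y)) 0 s := by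
    intro s
    obtain ⟨M, hM⟩ := ((isCompact_closedBall s 1).prod
      (isCompact_closedBall (0 : EuclideanSpace ℝ ι) δ)).exists_bound_of_continuousOn
      (f := fun p : ℝ × EuclideanSpace ℝ ι => fderiv ℝ (evalEuclidean H) (x + p.1 • p.2) p.2)
      ((hHd.comp (by fun_prop)).clm_apply continuous_snd).continuousOn
    have h := (hasDerivAt_integral_of_dominated_loc_of_deriv_le (μ := volume) (𝕜 := ℝ)
      (F := fun s y => radialKernel δ y * evalEuclidean H (x + s • y))
      (F' := fun s y => radialKernel δ y * fderiv ℝ (evalEuclidean H) (x + s • y) y)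
      (x₀ := s) (s := closedBall s 1) (bound := fun y => radialKernel δ y * M)
      (closedBall_mem_nhds s one_pos)
      (Eventually.of_forall fun s => (hcF s).aestronglyMeasurable)
      ((hcF s).integrable_of_hasCompactSupport hks.mul_right)
      (hcF' s).aestronglyMeasurable
      (Eventually.of_forall fun y t ht => by
        rw [norm_mul, Real.norm_of_nonneg (radialKernel_nonneg δ y)]
        by_cases hy : ‖y‖ ≤ δ
        · exact mul_le_mul_of_nonneg_left (hM (t, y) ⟨ht, by simpa using hy⟩)
            (radialKernel_nonneg δ y)
        · simp [radialKernel_eq_zero hδ (not_le.1 hy).le])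
      ((hk.mul continuous_const).integrable_of_hasCompactSupport hks.mul_right)
      (Eventually.of_forall fun y t _ => by
        have h1 : HasDerivAt (fun t : ℝ => x + t • y) y t := by
          simpa using ((hasDerivAt_id t).smul_const y).const_add x
        exact ((((contDiff_evalEuclidean H (n := 1)).differentiable (by norm_num)
          _).hasFDerivAt).comp_hasDerivAt t h1).const_mul _)).2
    refine h.congr_deriv ?_
    change ∫ y, radialKernel δ y * fderiv ℝ (evalEuclidean H) (x + s • y) y = 0
    have e1 : ∀ y, radialKernel δ y * fderiv ℝ (evalEuclidean H) (x + s • y) y =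
        ∑ i, radialKernel δ y *
          (y i * evalEuclidean (MvPolynomial.pderiv i H) (x + s • y)) := by
      intro y
      rw [fderiv_evalEuclidean_apply, Finset.mul_sum]
    simp only [e1]
    rw [integral_finsetSum]
    · simp only [integral_radialKernel_coord_mul hδ]
      rw [← Finset.mul_sum, ← integral_finsetSum]
      · have e2 : ∀ y, ∑ i, radialCutoff δ y * evalEuclidean (MvPolynomial.pderiv i
            (MvPolynomial.pderiv i H)) (x + s • y) = 0 := by
          intro y
          have h3 : evalEuclidean (polyLaplacian H) (x + s • y) = 0 := by
            rw [hH]; simp [evalEuclidean]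
          rw [← Finset.mul_sum]
          simp only [evalEuclidean, polyLaplacian, LinearMap.sum_apply, map_sum,
            LinearMap.comp_apply, Derivation.coeFn_coe] at h3 ⊢
          rw [h3, mul_zero]
        simp [e2]
      · intro i _
        have := continuous_evalEuclidean (MvPolynomial.pderiv i (MvPolynomial.pderiv i H))
        exact ((continuous_radialCutoff δ).mul (this.comp (by fun_prop))
          ).integrable_of_hasCompactSupport (hasCompactSupport_radialCutoff hδ).mul_right
    · intro i _
      have := continuous_evalEuclidean (MvPolynomial.pderiv i H)
      refine Continuous.integrable_of_hasCompactSupport ?_ hks.mul_right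
      fun_prop
  -- At `s = -1` the integral is the convolution with `H`; at `s = 0` it is the kernel mass times `H
  -- x`.
  have hconst := is_const_of_deriv_eq_zero (fun s => (hderiv s).differentiableAt)
    (fun s => (hderiv s).deriv) (-1) 0
  simp only [neg_smul, one_smul, zero_smul, add_zero, ← sub_eq_add_neg,
    integral_mul_const] at hconst
  exact hconst

/-- A locally uniform limit of harmonic polynomials is smooth. -/
theorem contDiffAt_of_uniform_limit_harmonic {U : EuclideanSpace ℝ ι → ℝ} {ρ : ℝ} (hρ : 0 < ρ)
    (hU : ContinuousOn U (closedBall 0 ρ))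
    (h : ∀ ε > 0, ∃ H : MvPolynomial ι ℝ, polyLaplacian H = 0 ∧
      ∀ z ∈ closedBall 0 ρ, |evalEuclidean H z - U z| ≤ ε) : ContDiffAt ℝ 2 U 0 := by
  have hδ : 0 < ρ / 2 := half_pos hρ
  -- Half the radius keeps `x - t` in the ball of radius `ρ` for `x` in the half ball and `t` in the
  -- support of the kernel.
  set δ := ρ / 2 with hδ_def
  set c := ∫ y : EuclideanSpace ℝ ι, radialKernel δ y with hc
  have hcpos : 0 < c := integral_radialKernel_pos hδ
  -- Nothing is known about `U` off the ball; cutting it off there makes the convolution globally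
  -- defined and smooth.
  set V := (closedBall (0 : EuclideanSpace ℝ ι) ρ).indicator U with hV
  have hVint : LocallyIntegrable V :=
    ((hU.integrableOn_compact (isCompact_closedBall 0 ρ)).integrable_indicator
      measurableSet_closedBall).locallyIntegrable
  have hk := continuous_radialKernel (ι := ι) δ
  have hks := hasCompactSupport_radialKernel (ι := ι) hδ
  have hsmooth := hks.contDiff_convolution_left (n := 2) (ContinuousLinearMap.mul ℝ ℝ)
    (contDiff_radialKernel δ) hVint
  have hex := hks.convolutionExists_left (ContinuousLinearMap.mul ℝ ℝ) hk hVint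
  -- Both the convolution and `c * U x` lie within `c * ε` of `c * evalEuclidean H x`, the former by
  -- the mean value property of `H`.
  have key : ∀ x ∈ ball (0 : EuclideanSpace ℝ ι) δ,
      U x = c⁻¹ * convolution (radialKernel δ) V (ContinuousLinearMap.mul ℝ ℝ) volume x := by
    intro x hx
    rw [mem_ball_zero_iff] at hx
    suffices hmain : ∀ ε > 0,
        |convolution (radialKernel δ) V (ContinuousLinearMap.mul ℝ ℝ) volume x - c * U x| ≤
          2 * c * ε by
      have h0 : |convolution (radialKernel δ) V (ContinuousLinearMap.mul ℝ ℝ) volume x - c * U x|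
          ≤ 0 := by
        refine le_of_forall_pos_le_add fun η hη => ?_
        have := hmain (η / (2 * c)) (by positivity)
        rwa [show 2 * c * (η / (2 * c)) = 0 + η by field_simp; ring] at this
      have := abs_nonpos_iff.1 h0
      rw [sub_eq_zero.1 this]
      field_simp
    intro ε hε
    obtain ⟨H, hH, hHU⟩ := h ε hε
    have hmv := integral_radialKernel_mul_evalEuclidean hδ hH x
    have hi1 : Integrable fun t => radialKernel δ t * V (x - t) := hex x
    have hi2 : Integrable fun t => radialKernel δ t * evalEuclidean H (x - t) := by
      have := continuous_evalEuclidean H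
      exact (hk.mul (this.comp (by fun_prop))).integrable_of_hasCompactSupport hks.mul_right
    have hconv : convolution (radialKernel δ) V (ContinuousLinearMap.mul ℝ ℝ) volume x =
        ∫ t, radialKernel δ t * V (x - t) := rfl
    have hdiff : |convolution (radialKernel δ) V (ContinuousLinearMap.mul ℝ ℝ) volume x -
        c * evalEuclidean H x| ≤ c * ε := by
      rw [hconv, ← hmv, ← integral_sub hi1 hi2, hc, ← integral_mul_const, ← Real.norm_eq_abs]
      refine norm_integral_le_of_norm_le
        ((hk.mul continuous_const).integrable_of_hasCompactSupport hks.mul_right)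
        (Eventually.of_forall fun t => ?_)
      by_cases ht : ‖t‖ ≤ δ
      · have hmem : x - t ∈ closedBall (0 : EuclideanSpace ℝ ι) ρ := by
          rw [mem_closedBall_zero_iff]
          linarith [norm_sub_le x t]
        rw [hV, Set.indicator_of_mem hmem, ← mul_sub, norm_mul,
          Real.norm_of_nonneg (radialKernel_nonneg δ t), Real.norm_eq_abs, abs_sub_comm]
        exact mul_le_mul_of_nonneg_left (hHU _ hmem) (radialKernel_nonneg δ t)
      · simp [radialKernel_eq_zero hδ (not_le.1 ht).le]
    have hx' := hHU x (mem_closedBall_zero_iff.2 (by linarith))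
    have h2 : |c * evalEuclidean H x - c * U x| ≤ c * ε := by
      rw [← mul_sub, abs_mul, abs_of_pos hcpos]
      exact mul_le_mul_of_nonneg_left hx' hcpos.le
    calc _ ≤ _ := abs_sub_le _ (c * evalEuclidean H x) _
      _ ≤ _ := by linarith
  have hU2 : ContDiffAt ℝ 2 (fun x => c⁻¹ *
      convolution (radialKernel δ) V (ContinuousLinearMap.mul ℝ ℝ) volume x) 0 :=
    (contDiff_const.mul hsmooth).contDiffAt
  exact hU2.congr_of_eventuallyEq (eventually_of_mem (ball_mem_nhds 0 hδ) key)

end Mollifier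

/-! ### The harmonic lift and regularity of `u`. -/

section Lift

variable {ι : Type*} [Fintype ι]

/-- The inclusion `x ↦ (0, x)` of Euclidean space as a coordinate hyperplane. -/
def euclideanIncl (ι : Type*) [Fintype ι] :
    EuclideanSpace ℝ ι →L[ℝ] EuclideanSpace ℝ (Option ι) :=
  LinearMap.toContinuousLinearMap
    { toFun := fun x => WithLp.toLp 2 fun o => o.elim 0 x.ofLp
      map_add' := fun x y => by ext o; cases o <;> simp
      map_smul' := fun c x => by ext o; cases o <;> simp }

/-- The projection `(t, x) ↦ x` to a coordinate hyperplane. -/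
def euclideanProj (ι : Type*) [Fintype ι] :
    EuclideanSpace ℝ (Option ι) →L[ℝ] EuclideanSpace ℝ ι :=
  LinearMap.toContinuousLinearMap
    { toFun := fun z => WithLp.toLp 2 fun i => z (some i)
      map_add' := fun x y => by ext i; simp
      map_smul' := fun c x => by ext i; simp }

@[simp] theorem euclideanIncl_none (x : EuclideanSpace ℝ ι) : euclideanIncl ι x none = 0 := rfl

@[simp] theorem euclideanIncl_some (x : EuclideanSpace ℝ ι) (i : ι) :
    euclideanIncl ι x (some i) = x i := rfl

@[simp] theorem euclideanProj_apply (z : EuclideanSpace ℝ (Option ι)) (i : ι) :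
    euclideanProj ι z i = z (some i) := rfl

@[simp] theorem euclideanProj_incl (x : EuclideanSpace ℝ ι) :
    euclideanProj ι (euclideanIncl ι x) = x := by
  ext i; simp

theorem euclideanIncl_basisFun (i : ι) :
    euclideanIncl ι (EuclideanSpace.basisFun ι ℝ i) =
      EuclideanSpace.basisFun (Option ι) ℝ (some i) := by
  classical
  ext o
  cases o <;> simp [PiLp.single_apply]

theorem norm_euclideanProj_le (z : EuclideanSpace ℝ (Option ι)) : ‖euclideanProj ι z‖ ≤ ‖z‖ := by
  rw [← sq_le_sq₀ (norm_nonneg _) (norm_nonneg _)]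
  rw [EuclideanSpace.real_norm_sq_eq, EuclideanSpace.real_norm_sq_eq, Fintype.sum_option]
  simpa using sq_nonneg (z none)

theorem fderiv_fderiv_comp_affine {E F : Type*} [NormedAddCommGroup E] [NormedSpace ℝ E]
    [NormedAddCommGroup F] [NormedSpace ℝ F] {f : F → ℝ} (hf : ContDiff ℝ 2 f) (L : E →L[ℝ] F)
    (z : F) (x₀ x v w : E) :
    fderiv ℝ (fderiv ℝ fun x => f (z + L (x - x₀))) x v w =
      fderiv ℝ (fderiv ℝ f) (z + L (x - x₀)) (L v) (L w) := by
  have haff : ∀ x, HasFDerivAt (fun x => z + L (x - x₀)) L x := fun x =>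
    (L.hasFDerivAt.comp x ((hasFDerivAt_id x).sub_const x₀)).const_add z
  have h1 : (fderiv ℝ fun x => f (z + L (x - x₀))) =
      fun x => (fderiv ℝ f (z + L (x - x₀))).comp L := funext fun x =>
    ((hf.differentiable (by norm_num) _).hasFDerivAt.comp x (haff x)).fderiv
  have h2 : DifferentiableAt ℝ (fderiv ℝ f) (z + L (x - x₀)) :=
    (hf.fderiv_right (m := 1) (by norm_num)).differentiable (by norm_num) _
  have h3 : HasFDerivAt (fun x => (fderiv ℝ f (z + L (x - x₀))).comp L) _ x :=
    (h2.hasFDerivAt.comp x (haff x)).clm_comp (hasFDerivAt_const L x)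
  rw [h1, h3.fderiv]
  simp

/-- If `a` were positive, the point would also be a local minimum, so `φ` would be locally constant
and `a = 0`. -/
theorem nonpos_of_isLocalMax_of_hasDerivAt {φ φ' : ℝ → ℝ} {x a : ℝ}
    (hφ : ∀ s, HasDerivAt φ (φ' s) s) (hφ' : HasDerivAt φ' a x) (hmax : IsLocalMax φ x) :
    a ≤ 0 := by
  by_contra! ha
  have hd : deriv φ = φ' := funext fun s => (hφ s).deriv
  have h0 : φ' x = 0 := hmax.hasDerivAt_eq_zero (hφ x)
  have hmin : IsLocalMin φ x := isLocalMin_of_deriv_deriv_pos (by rw [hd, hφ'.deriv]; exact ha)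
    (by rw [hd, h0]) (hφ x).continuousAt
  have hconst : φ =ᶠ[𝓝 x] fun _ => φ x := by
    filter_upwards [hmax, hmin] with s h1 h2 using le_antisymm h1 h2
  have hφ0 : φ' =ᶠ[𝓝 x] fun _ => 0 := by
    rw [← hd]
    refine hconst.deriv.trans ?_
    simp
  have := (hφ'.congr_of_eventuallyEq hφ0.symm).unique (hasDerivAt_const x (0 : ℝ))
  linarith

/-- The lift `(t, x) ↦ u(x₀ + x) exp(lam t)` turns solutions of the Helmholtz equation into harmonic
functions. -/
def helmholtzLift (lam : ℝ) (u : EuclideanSpace ℝ ι → ℝ) (x₀ : EuclideanSpace ℝ ι)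
    (z : EuclideanSpace ℝ (Option ι)) : ℝ :=
  u (x₀ + euclideanProj ι z) * Real.exp (lam * z none)

variable {lam ρ : ℝ} {u : EuclideanSpace ℝ ι → ℝ} {x₀ : EuclideanSpace ℝ ι}
  {D : Set (EuclideanSpace ℝ ι)}

theorem continuousOn_helmholtzLift (hu : ContinuousOn u D) (hsub : closedBall x₀ ρ ⊆ D) :
    ContinuousOn (helmholtzLift lam u x₀) (closedBall 0 ρ) := by
  refine ContinuousOn.mul (hu.comp (by fun_prop) fun z hz => hsub ?_) (by fun_prop)
  rw [mem_closedBall_zero_iff] at hz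
  simpa using (norm_euclideanProj_le z).trans hz

/-- No Laplacian of the lift in all variables is available, so an interior maximum is tested
separately on the slice of constant `t` and on the vertical line. The contributions `-lam ^ 2` and
`lam ^ 2` of the lift cancel in the sum, leaving the Laplacian of `Q`, which is positive: a
contradiction. -/
theorem helmholtzLift_sub_harmonic_le [Nonempty ι] (hρ : 0 < ρ) (hD : IsOpen D)
    (hu : ContinuousOn u D) (hsub : closedBall x₀ ρ ⊆ D)
    (hL : ∀ x ∈ D, HasBallLaplacian u x (-lam ^ 2 * u x))
    {H : MvPolynomial (Option ι) ℝ} (hH : polyLaplacian H = 0) {M : ℝ}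
    (hb : ∀ z ∈ sphere 0 ρ, helmholtzLift lam u x₀ z - evalEuclidean H z ≤ M) :
    ∀ z ∈ closedBall 0 ρ, helmholtzLift lam u x₀ z - evalEuclidean H z ≤ M := by
  refine le_of_forall_not_isLocalMax hρ ((continuousOn_helmholtzLift hu hsub).sub
    (continuous_evalEuclidean H).continuousOn) hb fun ε hε z hz hmax => ?_
  set Q : MvPolynomial (Option ι) ℝ := ε • polyNormSq (Option ι) - H with hQ
  have hfun : (fun z => helmholtzLift lam u x₀ z - evalEuclidean H z + ε * ‖z‖ ^ 2) =
      fun z => helmholtzLift lam u x₀ z + evalEuclidean Q z := by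
    ext z
    rw [← evalEuclidean_polyNormSq]
    simp only [hQ, evalEuclidean, map_sub, MvPolynomial.smul_eval]
    ring
  rw [hfun] at hmax
  have hQlap : evalEuclidean (polyLaplacian Q) z = ε * (2 * Fintype.card (Option ι)) := by
    rw [hQ, map_sub, hH, sub_zero, map_smul, polyLaplacian_polyNormSq]
    simp [evalEuclidean, MvPolynomial.smul_eval]
  have hQpos : 0 < evalEuclidean (polyLaplacian Q) z := by
    rw [hQlap]
    have : 0 < Fintype.card (Option ι) := Fintype.card_pos
    positivity
  rw [← sum_fderiv_evalEuclidean, Fintype.sum_option] at hQpos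
  simp only [fderiv_fderiv_evalEuclidean_basisFun] at hQpos
  set x₁ := x₀ + euclideanProj ι z with hx₁
  have hx₁D : x₁ ∈ D := by
    refine hsub ?_
    have := (norm_euclideanProj_le z).trans (mem_ball_zero_iff.1 hz).le
    simpa [hx₁] using this
  have hhor : Real.exp (lam * z none) * (-lam ^ 2 * u x₁) +
      ∑ i, evalEuclidean (MvPolynomial.pderiv (some i) (MvPolynomial.pderiv (some i) Q)) z ≤ 0 := by
    -- The restriction of `Q` to the horizontal slice through `z`, parametrized so that `x₁`
    -- corresponds to `z`.
    set q : EuclideanSpace ℝ ι → ℝ :=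
      fun x => evalEuclidean Q (z + euclideanIncl ι (x - x₁)) with hq
    have hqs : ContDiff ℝ 2 q := (contDiff_evalEuclidean Q).comp (by fun_prop)
    have hqlap := HasBallLaplacian.of_contDiffAt (hqs.contDiffAt (x := x₁))
    have hsum : ∀ i, fderiv ℝ (fderiv ℝ q) x₁ (EuclideanSpace.basisFun ι ℝ i)
        (EuclideanSpace.basisFun ι ℝ i) =
        evalEuclidean (MvPolynomial.pderiv (some i) (MvPolynomial.pderiv (some i) Q)) z := by
      intro i
      rw [hq, fderiv_fderiv_comp_affine (contDiff_evalEuclidean Q), euclideanIncl_basisFun,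
        sub_self, map_zero, add_zero, fderiv_fderiv_evalEuclidean_basisFun]
    simp only [hsum] at hqlap
    refine HasBallLaplacian.nonpos_of_isLocalMax (HasBallLaplacian.add (hD.mem_nhds hx₁D)
      (continuousOn_const.mul hu) hqs.continuous.continuousOn
      ((hL x₁ hx₁D).const_mul (Real.exp (lam * z none))) hqlap) ?_
    have hcont : Continuous fun x => z + euclideanIncl ι (x - x₁) := by fun_prop
    have hval : z + euclideanIncl ι (x₁ - x₁) = z := by simp
    have h1 := IsLocalMax.comp_continuous (g := fun x => z + euclideanIncl ι (x - x₁)) (b := x₁)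
      (by simpa only [hval] using hmax) hcont.continuousAt
    convert h1 using 1
    ext x
    simp only [Function.comp, helmholtzLift, hq, map_add, euclideanProj_incl, PiLp.add_apply,
      euclideanIncl_none, add_zero]
    rw [← add_assoc, ← hx₁, add_sub_cancel, mul_comm (u x)]
    rfl
  have hver : lam ^ 2 * (u x₁ * Real.exp (lam * z none)) +
      evalEuclidean (MvPolynomial.pderiv none (MvPolynomial.pderiv none Q)) z ≤ 0 := by
    set e := EuclideanSpace.basisFun (Option ι) ℝ none with he
    have hline : ∀ s : ℝ, HasDerivAt (fun s : ℝ => z + s • e) e s := fun s => by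
      simpa using ((hasDerivAt_id s).smul_const e).const_add z
    have hpoly : ∀ (P : MvPolynomial (Option ι) ℝ) (s : ℝ), HasDerivAt
        (fun s : ℝ => evalEuclidean P (z + s • e))
        (evalEuclidean (MvPolynomial.pderiv none P) (z + s • e)) s := by
      intro P s
      rw [← fderiv_evalEuclidean_basisFun]
      exact (((contDiff_evalEuclidean P (n := 1)).differentiable (by norm_num)
        _).hasFDerivAt).comp_hasDerivAt s (hline s)
    have hexp : ∀ (c s : ℝ), HasDerivAt (fun s : ℝ => c * Real.exp (lam * (z none + s)))
        (c * lam * Real.exp (lam * (z none + s))) s := by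
      intro c s
      have h1 : HasDerivAt (fun s : ℝ => lam * (z none + s)) lam s := by
        simpa using ((hasDerivAt_id s).const_add (z none)).const_mul lam
      refine (h1.exp.const_mul c).congr_deriv ?_
      ring
    have h2 := nonpos_of_isLocalMax_of_hasDerivAt
      (fun s => (hexp (u x₁) s).add (hpoly Q s))
      ((hexp (u x₁ * lam) 0).add (hpoly (MvPolynomial.pderiv none Q) 0)) (by
        have hcont : Continuous fun s : ℝ => z + s • e := by fun_prop
        have hval : z + (0 : ℝ) • e = z := by simp
        have h1 := IsLocalMax.comp_continuous (g := fun s : ℝ => z + s • e) (b := 0)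
          (by simpa only [hval] using hmax) hcont.continuousAt
        convert h1 using 1
        ext s
        have he1 : euclideanProj ι e = 0 := by
          classical
          ext i
          simp [he]
        have he2 : e none = 1 := by
          classical
          simp [he]
        simp [helmholtzLift, he1, he2, hx₁])
    simp only [add_zero, zero_smul] at h2
    linarith
  linarith

/-- The comparison for `u` and for `-u` bounds the lift minus `H` from both sides, so the lift is a
uniform limit of harmonic polynomials on the ball. -/
theorem contDiffAt_of_hasBallLaplacian [Nonempty ι] (hD : IsOpen D) (hu : ContinuousOn u D)
    (hL : ∀ x ∈ D, HasBallLaplacian u x (-lam ^ 2 * u x)) (hx₀ : x₀ ∈ D) :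
    ContDiffAt ℝ 2 u x₀ := by
  obtain ⟨ρ, hρ, hsub⟩ := Metric.nhds_basis_closedBall.mem_iff.1 (hD.mem_nhds hx₀)
  have hcont : ContinuousOn (helmholtzLift lam u x₀) (closedBall 0 ρ) :=
    continuousOn_helmholtzLift hu hsub
  have hlift : ContDiffAt ℝ 2 (helmholtzLift lam u x₀) 0 := by
    refine contDiffAt_of_uniform_limit_harmonic hρ hcont fun ε hε => ?_
    obtain ⟨H, hH, hHU⟩ := exists_harmonic_polynomial_near hρ
      (hcont.mono sphere_subset_closedBall) hε
    refine ⟨H, hH, fun z hz => ?_⟩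
    have h1 := helmholtzLift_sub_harmonic_le hρ hD hu hsub hL hH (M := ε)
      (fun z hz => by linarith [(abs_lt.1 (hHU z hz)).1]) z hz
    have hLneg : ∀ x ∈ D, HasBallLaplacian (fun x => -1 * u x) x (-lam ^ 2 * (-1 * u x)) := by
      intro x hx
      have := (hL x hx).const_mul (-1)
      rwa [show -1 * (-lam ^ 2 * u x) = -lam ^ 2 * (-1 * u x) by ring] at this
    have hHneg : polyLaplacian (-H) = 0 := by rw [map_neg, hH, neg_zero]
    have hdiff : ∀ z, helmholtzLift lam (fun x => -1 * u x) x₀ z - evalEuclidean (-H) z =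
        evalEuclidean H z - helmholtzLift lam u x₀ z := by
      intro z
      simp only [helmholtzLift, evalEuclidean, map_neg]
      ring
    have h2 := helmholtzLift_sub_harmonic_le hρ hD
      (u := fun x => -1 * u x) (continuousOn_const.mul hu) hsub hLneg hHneg (M := ε)
      (fun z hz => by rw [hdiff]; linarith [(abs_lt.1 (hHU z hz)).2]) z hz
    rw [hdiff] at h2
    exact abs_le.2 ⟨by linarith, h2⟩
  -- On the slice `t = 0` the exponential equals one.
  have heq : u = fun x => helmholtzLift lam u x₀ (euclideanIncl ι (x - x₀)) := by
    ext x
    simp [helmholtzLift]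
  rw [heq]
  refine ContDiffAt.comp x₀ (g := helmholtzLift lam u x₀) (by simpa using hlift) ?_
  fun_prop

end Lift

/-! ### Conclusion. -/

theorem corollary1 (m : ℕ) (hm : 2 ≤ m) (D : Set (EuclideanSpace ℝ (Fin m)))
    (hDopen : IsOpen D) (hDconn : IsConnected D) (hDbdd : Bornology.IsBounded D)
    (u : EuclideanSpace ℝ (Fin m) → ℝ) (hu : ContinuousOn u D)
    (lam : ℝ) (hlam : 0 < lam)
    (R : EuclideanSpace ℝ (Fin m) → ℝ)
    (hR : ∀ x ∈ D, 0 < R x ∧ IsAdmissibleBall D x (R x))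
    (hmean : ∀ x ∈ D, ∀ r : ℝ, 0 < r → r < R x →
      (2 * Real.pi * r / lam) ^ ((m : ℝ) / 2) * besselJ ((m : ℝ) / 2) (lam * r) * u x =
        ∫ y in Metric.ball (0 : EuclideanSpace ℝ (Fin m)) r, u (x + y)) :
    IsMetaharmonicOn lam u D := by
  have : Nonempty (Fin m) := ⟨⟨0, by omega⟩⟩
  have hL : ∀ x ∈ D, HasBallLaplacian u x (-lam ^ 2 * u x) := fun x hx =>
    hasBallLaplacian_of_mean_value hm hu hlam (hDopen.mem_nhds hx) (hR x hx).1 (hmean x hx)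
  have hC : ∀ x ∈ D, ContDiffAt ℝ 2 u x := fun x hx =>
    contDiffAt_of_hasBallLaplacian hDopen hu hL hx
  refine ⟨fun x hx => (hC x hx).contDiffWithinAt, fun x hx => ?_⟩
  -- Once `u` is `C²`, its classical Laplacian is also its generalized one, and limits are unique.
  have h := (hL x hx).eq (HasBallLaplacian.of_contDiffAt (hC x hx))
  rw [laplacian_eq_sum_fderiv, ← h]
  ring

end
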